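/- **Setting.** Let $S_j(x)=\rho_jx+b_j$ ($1\le j\le m$, $0<|\rho_j|<1$) be a linear iterated function system on $\mathbb R$ with attractor $K$, i.e. $K$ is the unique non-empty compact set with $K=\bigcup_jS_j(K)$. Assume that $\bigcup_jS_j((0,1))\subset(0,1)$. For a finite word $\mathbf i=(i_1,\dots,i_k)$ over $\{1,\dots,m\}$ write $S_{\mathbf i}=S_{i_1}\circ\cdots\circ S_{i_k}$ ($S_\emptyset=\mathrm{id}$) and $|\mathbf i|=k$, and write $\mathbf i\preceq\mathbf j$ if $\mathbf i$ is an initial segment of $\mathbf j$. For $E\subset\mathbb R$, $|E|$ denotes the diameter of $E$. A *sequence of nested index sets* is a sequence $(\mathcal M_k)_{k\ge0}$ of non-empty finite sets of words with $\mathcal M_0=\{\emptyset\}$ such that: (1) $\min_{\mathbf i\in\mathcal M_k}|\mathbf i|$ and $\max_{\mathbf i\in\mathcal M_k}|\mathbf i|$ are non-decreasing in $k$ and tend to infinity; (2) distinct words of $\mathcal M_k$ are incomparable for $\preceq$; (3) every word $\mathbf j$ with $|\mathbf j|>\max_{\mathbf i\in\mathcal M_k}|\mathbf i|$ satisfies $\mathbf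 i\preceq\mathbf j$ for some $\mathbf i\in\mathcal M_k$; (4) every word $\mathbf j$ with $|\mathbf j|<\min_{\mathbf i\in\mathcal M_k}|\mathbf i|$ satisfies $\mathbf j\preceq\mathbf i$ for some $\mathbf i\in\mathcal M_k$; (5) there is a positive integer $L$ with $|\mathbf j|-|\mathbf i|\le L$ whenever $k\ge0$, $\mathbf i\in\mathcal M_k$, $\mathbf j\in\mathcal M_{k+1}$ and $\mathbf i\preceq\mathbf j$. Fix such a sequence. A *$k$-th generation island* is the closure of a connected component of the open set $\bigcup_{\mathbf i\in\mathcal M_k}S_{\mathbf i}((0,1))$; an island is always considered together with its generation. For a $k$-th generation island $I$ let $\mathcal S(I)=\{S_{\mathbf i}:\mathbf i\in\mathcal M_k,\ S_{\mathbf i}([0,1])\subset I\}$. A $k$-th generation island $I$ and a $k'$-th generation island $I'$ are *equivalent* if there is a function $\tau(x)=ax+b$, $a\neq0$, with $\tau(I)=I'$ such that (i) $\mathcal S(I')=\{\tau\circ f:f\in\mathcal S(I)\}$, and (ii) for every $l\ge1$ and every $J\subset\mathbb R$, $J$ is a $(k+l)$-th generation island contained in $I$ if and only if $\tau(J)$ is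 a $(k'+l)$-th generation island contained in $I'$. The equivalence classes are called *overlap types*. The system satisfies the *generalized finite type condition* (GFTC) with respect to $(0,1)$ if, for some sequence of nested index sets, there are only finitely many overlap types $\mathcal T_1,\dots,\mathcal T_q$. Assume this and fix such a sequence, and fix for each $i$ an island $I^{(i)}$ of type $\mathcal T_i$, of generation $k_i$ say. For $\alpha\ge0$ the *weighted incidence matrix* $A_\alpha$ is the $q\times q$ matrix $$A_\alpha(i,j)=\sum_{J}\Big(\frac{|J|}{|I^{(i)}|}\Big)^{\alpha},$$ where $J$ runs over the $(k_i+1)$-th generation islands of type $\mathcal T_j$ contained in $I^{(i)}$. **Theorem.** Let $K$ be as above, with the GFTC satisfied with respect to $(0,1)$, let $\alpha=\dim_HK$ be the Hausdorff dimension of $K$, and suppose that $A_\alpha$ is irreducible (for the fixed choice of index sets and islands, which is arbitrary). Then $$\mathcal H^\alpha(K\cap J)\le|J|^\alpha$$ for every interval $J\subset[0,1]$, where $\mathcal H^\alpha$ is the $\alpha$-dimensional Hausdorff measure (and $0^0=1$). -/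

import Mathlib

open Set Filter MeasureTheory Measure
open scoped NNReal ENNReal

/-- A linear iterated function system `S_j(x) = ρ_j x + b_j`, `j = 1, …, m`, on the real line,
with contraction ratios `0 < |ρ_j| < 1` (negative `ρ_j` are allowed). -/
structure LinearIFS (m : ℕ) where
  ρ : Fin m → ℝ
  b : Fin m → ℝ
  abs_pos : ∀ j, 0 < |ρ j|
  abs_lt_one : ∀ j, |ρ j| < 1

namespace LinearIFS

/-- The similitude `S_j`. -/
def map {m : ℕ} (S : LinearIFS m) (j : Fin m) (x : ℝ) : ℝ := S.ρ j * x + S.b j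

/-- `S_i = S_{i_1} ∘ ⋯ ∘ S_{i_k}` for a finite word `i = (i_1, …, i_k)`; the empty word gives
the identity. -/
def wordMap {m : ℕ} (S : LinearIFS m) : List (Fin m) → ℝ → ℝ
  | [] => id
  | j :: w => S.map j ∘ S.wordMap w

/-- `K` is the attractor (self-similar set) of the system: the unique non-empty compact set with
`K = ⋃ j, S_j(K)`. -/
def IsAttractor {m : ℕ} (S : LinearIFS m) (K : Set ℝ) : Prop :=
  K.Nonempty ∧ IsCompact K ∧ K = ⋃ j, S.map j '' K

/-- The open set `(0,1)` is invariant under the system. -/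
def UnitInvariant {m : ℕ} (S : LinearIFS m) : Prop :=
  ⋃ j, S.map j '' Ioo 0 1 ⊆ Ioo 0 1

/-- The minimal length of a word in a (non-empty) finite set of words. -/
noncomputable def minLength {m : ℕ} (A : Finset (List (Fin m))) : ℕ :=
  sInf (List.length '' (A : Set (List (Fin m))))

/-- The maximal length of a word in a (non-empty) finite set of words. -/
def maxLength {m : ℕ} (A : Finset (List (Fin m))) : ℕ := A.sup List.length

/-- Sequences of nested index sets. Words are lists; `i <+: j` says that `i` is an initial segment
of `j`. -/
structure IsNestedIndexSequence {m : ℕ} (M : ℕ → Finset (List (Fin m))) : Prop where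
  nonempty : ∀ k, (M k).Nonempty
  zero : M 0 = {[]}
  monotone_min : Monotone fun k => minLength (M k)
  monotone_max : Monotone fun k => maxLength (M k)
  tendsto_min : Tendsto (fun k => minLength (M k)) atTop atTop
  tendsto_max : Tendsto (fun k => maxLength (M k)) atTop atTop
  incomparable : ∀ k, ∀ i ∈ M k, ∀ j ∈ M k, i ≠ j → ¬ i <+: j
  exists_prefix : ∀ k, ∀ j : List (Fin m), maxLength (M k) < j.length → ∃ i ∈ M k, i <+: j
  exists_extension : ∀ k, ∀ j : List (Fin m), j.length < minLength (M k) → ∃ i ∈ M k, j <+: i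
  bounded_step : ∃ L : ℕ, 0 < L ∧ ∀ k, ∀ i ∈ M k, ∀ j ∈ M (k + 1), i <+: j →
    j.length - i.length ≤ L

/-- The maps `S_v` of the vertices `v` of generation `k`. Words with the same map give the same
vertex. -/
def vertexMaps {m : ℕ} (S : LinearIFS m) (M : ℕ → Finset (List (Fin m))) (k : ℕ) :
    Set (ℝ → ℝ) :=
  S.wordMap '' (M k : Set (List (Fin m)))

/-- The open set `⋃ v, S_v((0,1))`, the union over all vertices `v` of generation `k`. -/
def generationSet {m : ℕ} (S : LinearIFS m) (M : ℕ → Finset (List (Fin m))) (k : ℕ) : Set ℝ :=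
  ⋃ f ∈ S.vertexMaps M k, f '' Ioo 0 1

/-- `I` is an island of generation `k`: the closure of a connected component of the open set
`⋃ v, S_v((0,1))`. -/
def IsIsland {m : ℕ} (S : LinearIFS m) (M : ℕ → Finset (List (Fin m))) (k : ℕ)
    (I : Set ℝ) : Prop :=
  ∃ x ∈ S.generationSet M k, I = closure (connectedComponentIn (S.generationSet M k) x)

/-- The maps `S_v` of the vertices `v` in `V(I)`, that is, of those vertices `v` of generation `k`
whose interval `S_v([0,1])` is contained in `I`. -/
def constituents {m : ℕ} (S : LinearIFS m) (M : ℕ → Finset (List (Fin m))) (k : ℕ)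
    (I : Set ℝ) : Set (ℝ → ℝ) :=
  {f | f ∈ S.vertexMaps M k ∧ f '' Icc 0 1 ⊆ I}

/-- An island together with its generation. -/
structure Island {m : ℕ} (S : LinearIFS m) (M : ℕ → Finset (List (Fin m))) where
  gen : ℕ
  carrier : Set ℝ
  isIsland : S.IsIsland M gen carrier

/-- Equivalence of islands: some (non-constant) function `τ x = a x + b` maps `I` onto `I'`,
carries the maps of the vertices of `I` to those of `I'`, and for every `l ≥ 1` carries the islands
`l` generations later inside `I` to those inside `I'`. -/
def Island.Equivalent {m : ℕ} {S : LinearIFS m} {M : ℕ → Finset (List (Fin m))}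
    (I I' : S.Island M) : Prop :=
  ∃ τ : ℝ ≃ᵃ[ℝ] ℝ,
    τ '' I.carrier = I'.carrier ∧
    S.constituents M I'.gen I'.carrier = (fun f => τ ∘ f) '' S.constituents M I.gen I.carrier ∧
    ∀ l : ℕ, 1 ≤ l → ∀ J : Set ℝ,
      (S.IsIsland M (I.gen + l) J ∧ J ⊆ I.carrier) ↔
        (S.IsIsland M (I'.gen + l) (τ '' J) ∧ τ '' J ⊆ I'.carrier)

theorem Island.Equivalent.refl {m : ℕ} {S : LinearIFS m} {M : ℕ → Finset (List (Fin m))}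
    (I : S.Island M) : I.Equivalent I :=
  ⟨AffineEquiv.refl ℝ ℝ, by simp, by ext f; simp, fun l _ J => by simp⟩

theorem Island.Equivalent.symm {m : ℕ} {S : LinearIFS m} {M : ℕ → Finset (List (Fin m))}
    {I I' : S.Island M} (h : I.Equivalent I') : I'.Equivalent I := by
  obtain ⟨τ, h1, h2, h3⟩ := h
  have key : ∀ s : Set ℝ, τ '' (τ.symm '' s) = s := fun s => by
    rw [image_image]; simp only [AffineEquiv.apply_symm_apply, image_id']
  have key' : ∀ s : Set ℝ, τ.symm '' (τ '' s) = s := fun s => by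
    rw [image_image]; simp only [AffineEquiv.symm_apply_apply, image_id']
  refine ⟨τ.symm, by rw [← h1, key'], ?_, fun l hl J => ?_⟩
  · rw [h2, image_image]
    have e : ∀ f : ℝ → ℝ, τ.symm ∘ (τ ∘ f) = f := fun f => by funext x; simp
    simp only [e, image_id']
  · rw [h3 l hl, key]

theorem Island.Equivalent.trans {m : ℕ} {S : LinearIFS m} {M : ℕ → Finset (List (Fin m))}
    {I I' I'' : S.Island M} (h : I.Equivalent I') (h' : I'.Equivalent I'') :
    I.Equivalent I'' := by
  obtain ⟨τ, h1, h2, h3⟩ := h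
  obtain ⟨σ, g1, g2, g3⟩ := h'
  have key : ∀ s : Set ℝ, (τ.trans σ) '' s = σ '' (τ '' s) := fun s => by
    rw [← image_comp]; rfl
  refine ⟨τ.trans σ, by rw [key, h1, g1], ?_, fun l hl J => ?_⟩
  · rw [g2, h2, ← image_comp]
    rfl
  · rw [h3 l hl, g3 l hl, key]

/-- The equivalence relation on islands whose classes are the overlap types. -/
def islandSetoid {m : ℕ} (S : LinearIFS m) (M : ℕ → Finset (List (Fin m))) :
    Setoid (S.Island M) where
  r := Island.Equivalent
  iseqv := ⟨Island.Equivalent.refl, Island.Equivalent.symm, Island.Equivalent.trans⟩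

/-- The overlap types: equivalence classes of islands. -/
def OverlapType {m : ℕ} (S : LinearIFS m) (M : ℕ → Finset (List (Fin m))) : Type :=
  Quotient (S.islandSetoid M)

/-- The overlap type `[I]` of an island `I`. -/
def Island.type {m : ℕ} {S : LinearIFS m} {M : ℕ → Finset (List (Fin m))} (I : S.Island M) :
    S.OverlapType M :=
  Quotient.mk (S.islandSetoid M) I

/-- The system satisfies the generalized finite type condition with respect to the invariant open
set `(0,1)`, the sequence of nested index sets being `M`. -/
structure IsGFTC {m : ℕ} (S : LinearIFS m) (M : ℕ → Finset (List (Fin m))) : Prop where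
  invariant : S.UnitInvariant
  nested : IsNestedIndexSequence M
  finite_types : Finite (S.OverlapType M)

/-- The offspring of type `t` of an island `I`: the islands of the next generation that are
contained in `I` and have overlap type `t`. -/
def offspring {m : ℕ} {S : LinearIFS m} {M : ℕ → Finset (List (Fin m))} (I : S.Island M)
    (t : S.OverlapType M) : Set (S.Island M) :=
  {J | J.gen = I.gen + 1 ∧ J.carrier ⊆ I.carrier ∧ J.type = t}

/-- Each generation has finitely many islands. -/
theorem finite_isIsland {m : ℕ} (S : LinearIFS m) (M : ℕ → Finset (List (Fin m))) (k : ℕ) :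
    {I | S.IsIsland M k I}.Finite := by
  have hcont : ∀ w : List (Fin m), Continuous (S.wordMap w) := by
    intro w
    induction w with
    | nil => exact continuous_id
    | cons j w ih =>
      refine Continuous.comp ?_ ih
      unfold LinearIFS.map
      fun_prop
  refine ((M k).finite_toSet.image fun w =>
    closure (connectedComponentIn (S.generationSet M k) (S.wordMap w (1 / 2)))).subset ?_
  rintro I ⟨x, hx, rfl⟩
  have hx' := hx
  simp only [generationSet, vertexMaps, mem_iUnion, exists_prop] at hx'
  obtain ⟨f, ⟨w, hw, rfl⟩, hxw⟩ := hx'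
  refine ⟨w, hw, ?_⟩
  have hsub : S.wordMap w '' Ioo 0 1 ⊆ S.generationSet M k :=
    subset_biUnion_of_mem (u := fun f : ℝ → ℝ => f '' Ioo 0 1) (mem_image_of_mem _ hw)
  have hpre : IsPreconnected (S.wordMap w '' Ioo 0 1) :=
    isPreconnected_Ioo.image _ (hcont w).continuousOn
  have hmem := hpre.subset_connectedComponentIn hxw hsub
    (mem_image_of_mem (S.wordMap w) (show (1 / 2 : ℝ) ∈ Ioo 0 1 by norm_num))
  simp only [connectedComponentIn_eq hmem]

/-- An island has finitely many offspring, so that the sums below are finite sums. -/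
theorem finite_offspring {m : ℕ} {S : LinearIFS m} {M : ℕ → Finset (List (Fin m))}
    (I : S.Island M) (t : S.OverlapType M) : (offspring I t).Finite := by
  refine Set.Finite.of_finite_image (f := Island.carrier)
    ((S.finite_isIsland M (I.gen + 1)).subset ?_) ?_
  · rintro _ ⟨J, hJ, rfl⟩
    have := J.isIsland
    rw [hJ.1] at this
    exact this
  · rintro ⟨k, A, hA⟩ h ⟨k', A', hA'⟩ h' (e : A = A')
    obtain rfl : k = k' := h.1.trans h'.1.symm
    subst e
    rfl

/-- The weighted incidence matrix `A_α`, indexed by the overlap types and computed from an island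
`rep t` of each type `t`. Its entry at `(s, t)` is the sum of `(|J| / |rep s|) ^ α` over the
offspring `J` of `rep s` that have type `t`. -/
noncomputable def incidenceMatrix {m : ℕ} {S : LinearIFS m} {M : ℕ → Finset (List (Fin m))}
    (rep : S.OverlapType M → S.Island M) (α : ℝ) :
    Matrix (S.OverlapType M) (S.OverlapType M) ℝ :=
  fun s t => ∑ J ∈ (finite_offspring (rep s) t).toFinset,
    (Metric.diam J.carrier / Metric.diam (rep s).carrier) ^ α

end LinearIFS

/-! The bound expresses the optimality of covers in the definition of Hausdorff measure, combined
with self-similarity. Suppose $\mathcal H^s(K\cap J)>|J|^s+\delta$ with $s=\dim_H K$. At each scale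
$r$ choose a maximal disjoint family of copies $S_w(K\cup J)$ with ratios comparable to $r$. The
sets $S_w(J)$ are covers that are too cheap: they cost at most $\sum_w\rho_w^s|J|^s$, where $\rho_w$
denotes the ratio of $S_w$, but carry mass at least $\sum_w\rho_w^s(|J|^s+\delta)$. By maximality,
enlarged copies cover $K$, so $\sum_w\rho_w^s$ is bounded below independently of $r$. Thus all
premeasures of $K$ stay a fixed amount below $\mathcal H^s(K)$, although their supremum is $\mathcal
H^s(K)$. This is absurd once $\mathcal H^s(K)<\infty$.

Finiteness comes from a packing bound, `card_mul_rpow_dimH_le_one`: if $K$ contains $N$ disjoint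
copies of itself of ratio at least $a$, then $Na^s\le1$, since otherwise $Na^t\ge1$ for some $t>s$
and $\mathcal H^t(K)>0$. Applied to a maximal disjoint family from `exists_disjoint_words`, it
bounds the cost of covering $K$ by enlarged copies. -/

/-! ### Disjoint copies and lower bounds for the dimension -/

/-- If separated copies of `K`, each shrunk by a factor at least `a`, lie inside `K` and there are
at least `a ^ (-t)` of them, then every finite cover of `K` has `t`-dimensional size at least
`d ^ t`, where `d` bounds the gaps between the copies from below. -/
theorem rpow_le_sum_ediam_of_separated_copies {X ι κ : Type*} [EMetricSpace X] {K : Set X}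
    (hK : K.Nonempty) {t : ℝ} (ht : 0 ≤ t) {a : ℝ≥0} (ha : a ≠ 0) {W : Finset ι}
    {f : ι → X → X} (hf : ∀ i ∈ W, AntilipschitzWith a⁻¹ (f i)) (hfK : ∀ i ∈ W, MapsTo (f i) K K)
    {d : ℝ≥0∞}
    (hd : ∀ i ∈ W, ∀ j ∈ W, i ≠ j → ∀ x ∈ f i '' K, ∀ y ∈ f j '' K, d ≤ edist x y)
    (hW : 1 < W.card) (hcard : 1 ≤ (W.card : ℝ≥0∞) * (a : ℝ≥0∞) ^ t) :
    ∀ (F : Finset κ) (U : κ → Set X), K ⊆ ⋃ k ∈ F, U k →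
      d ^ t ≤ ∑ k ∈ F, Metric.ediam (U k) ^ t := by
  classical
  intro F
  induction F using Finset.strongInduction with
  | H F ih =>
  intro U hU
  by_cases hbig : ∃ k ∈ F, ∃ i ∈ W, ∃ j ∈ W, i ≠ j ∧ (U k ∩ f i '' K).Nonempty ∧
      (U k ∩ f j '' K).Nonempty
  · obtain ⟨k, hk, i, hi, j, hj, hij, ⟨x, hxU, hx⟩, ⟨y, hyU, hy⟩⟩ := hbig
    calc d ^ t ≤ Metric.ediam (U k) ^ t := by
          gcongr
          exact (hd i hi j hj hij x hx y hy).trans (Metric.edist_le_ediam_of_mem hxU hyU)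
      _ ≤ _ := Finset.single_le_sum (f := fun k => Metric.ediam (U k) ^ t)
          (fun _ _ => zero_le) hk
  -- No member of the cover meets two copies, so the members fall into disjoint classes `G i`, one
  -- per copy. Pulling `G i` back by `f i` covers `K` with fewer sets.
  · push Not at hbig
    let G : ι → Finset κ := fun i => F.filter fun k => (U k ∩ f i '' K).Nonempty
    have hGdisj : (W : Set ι).PairwiseDisjoint G := by
      intro i hi j hj hij
      rw [Function.onFun, Finset.disjoint_left]
      intro k hki hkj
      rw [Finset.mem_filter] at hki hkj
      exact hkj.2.ne_empty (hbig k hki.1 i hi j hj hij hki.2)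
    have hcov : ∀ i ∈ W, K ⊆ ⋃ k ∈ G i, f i ⁻¹' U k := by
      intro i hi x hx
      obtain ⟨k, hk, hxk⟩ := mem_iUnion₂.1 (hU (hfK i hi hx))
      exact mem_iUnion₂.2 ⟨k, Finset.mem_filter.2 ⟨hk, f i x, hxk, mem_image_of_mem _ hx⟩, hxk⟩
    have hGne : ∀ i ∈ W, (G i).Nonempty := by
      intro i hi
      obtain ⟨x, hx⟩ := hK
      obtain ⟨k, hk, -⟩ := mem_iUnion₂.1 (hcov i hi hx)
      exact ⟨k, hk⟩
    have hGF : ∀ i ∈ W, G i ⊂ F := by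
      intro i hi
      -- A second copy makes the inclusion strict: its class is non-empty and disjoint from `G i`.
      obtain ⟨j, hj, hji⟩ := Finset.exists_mem_ne hW i
      obtain ⟨k, hk⟩ := hGne j hj
      refine (Finset.ssubset_iff_of_subset (Finset.filter_subset _ _)).2
        ⟨k, (Finset.mem_filter.1 hk).1, fun hk' => ?_⟩
      exact Finset.disjoint_left.1 (hGdisj hj hi hji) hk hk'
    have ha0 : (a : ℝ≥0∞) ≠ 0 := by simpa using ha
    have hstep : ∀ i ∈ W, (a : ℝ≥0∞) ^ t * d ^ t ≤ ∑ k ∈ G i, Metric.ediam (U k) ^ t := by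
      intro i hi
      refine (mul_le_mul_right (ih (G i) (hGF i hi) _ (hcov i hi)) _).trans ?_
      rw [Finset.mul_sum]
      refine Finset.sum_le_sum fun k _ => ?_
      rw [← ENNReal.mul_rpow_of_nonneg _ _ ht]
      gcongr
      refine (mul_le_mul_right ((hf i hi).ediam_preimage_le (U k)) _).trans ?_
      rw [ENNReal.coe_inv ha, ← mul_assoc, ENNReal.mul_inv_cancel ha0 ENNReal.coe_ne_top, one_mul]
    calc d ^ t ≤ (W.card * (a : ℝ≥0∞) ^ t) * d ^ t := le_mul_of_one_le_left zero_le hcard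
      _ = ∑ i ∈ W, (a : ℝ≥0∞) ^ t * d ^ t := by
          rw [Finset.sum_const, nsmul_eq_mul, mul_assoc]
      _ ≤ ∑ i ∈ W, ∑ k ∈ G i, Metric.ediam (U k) ^ t := Finset.sum_le_sum hstep
      _ = ∑ k ∈ W.biUnion G, Metric.ediam (U k) ^ t := (Finset.sum_biUnion hGdisj).symm
      _ ≤ ∑ k ∈ F, Metric.ediam (U k) ^ t :=
          Finset.sum_le_sum_of_subset (Finset.biUnion_subset.2 fun i _ => Finset.filter_subset _ _)

/-- A set of finite diameter lies in an open set of almost the same `t`-dimensional size. -/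
theorem exists_isOpen_superset_ediam_rpow_le {X : Type*} [EMetricSpace X] {A : Set X}
    (hA : Metric.ediam A ≠ ∞) {t : ℝ} (ht : 0 ≤ t) {ε : ℝ≥0} (hε : 0 < ε) :
    ∃ V, IsOpen V ∧ A ⊆ V ∧ Metric.ediam V ^ t ≤ Metric.ediam A ^ t + ε := by
  have hcont : Continuous fun δ : ℝ≥0 => (Metric.ediam A + 2 * δ) ^ t := by
    refine ENNReal.continuous_rpow_const.comp (continuous_const.add ?_)
    exact ENNReal.continuous_const_mul (by simp) |>.comp ENNReal.continuous_coe
  have hfin : Metric.ediam A ^ t ≠ ∞ := ENNReal.rpow_ne_top_of_nonneg ht hA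
  have hlt : ∀ᶠ δ : ℝ≥0 in nhdsWithin 0 (Ioi 0),
      (Metric.ediam A + 2 * δ) ^ t < Metric.ediam A ^ t + ε := by
    refine (hcont.tendsto 0).mono_left nhdsWithin_le_nhds |>.eventually_lt_const ?_
    simpa using ENNReal.lt_add_right hfin (by simpa using hε.ne')
  obtain ⟨δ, hδ, hδ0⟩ := (hlt.and self_mem_nhdsWithin).exists
  refine ⟨Metric.thickening δ A, Metric.isOpen_thickening,
    Metric.self_subset_thickening (by simpa using hδ0) A, le_trans ?_ hδ.le⟩
  gcongr
  exact Metric.ediam_thickening_le δ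

/-- A compact set all of whose finite covers have `t`-dimensional size bounded below has positive
`t`-dimensional Hausdorff measure. -/
theorem hausdorffMeasure_ne_zero_of_le_sum_ediam {X : Type*} [EMetricSpace X]
    [MeasurableSpace X] [BorelSpace X] {K : Set X} (hK : IsCompact K) {t : ℝ} (ht : 0 < t)
    {c : ℝ≥0∞} (hc : c ≠ 0)
    (h : ∀ (F : Finset ℕ) (U : ℕ → Set X), K ⊆ ⋃ k ∈ F, U k →
      c ≤ ∑ k ∈ F, Metric.ediam (U k) ^ t) : μH[t] K ≠ 0 := by
  intro h0
  rw [hausdorffMeasure_apply, ENNReal.iSup_eq_zero] at h0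
  -- Any finite scale would do: it only has to force finite diameters, so that the covering sets can
  -- be thickened to open ones.
  have h1 := h0 1
  rw [ENNReal.iSup_eq_zero] at h1
  have h2 := h1 one_pos
  have hc2 : 0 < c / 2 := ENNReal.half_pos hc
  obtain ⟨A, hA⟩ := iInf_lt_iff.1 (h2.trans_lt hc2)
  obtain ⟨hKA, hA⟩ := iInf_lt_iff.1 hA
  obtain ⟨hA1, hA⟩ := iInf_lt_iff.1 hA
  obtain ⟨ε, hε, hεsum⟩ := ENNReal.exists_pos_sum_of_countable hc2.ne' ℕ
  choose V hVo hAV hV using fun n => exists_isOpen_superset_ediam_rpow_le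
    ((hA1 n).trans_lt ENNReal.one_lt_top).ne ht.le (hε n)
  obtain ⟨F, hF⟩ := hK.elim_finite_subcover V hVo (hKA.trans (iUnion_mono hAV))
  have hle : ∀ n, Metric.ediam (A n) ^ t ≤ ⨆ _ : (A n).Nonempty, Metric.ediam (A n) ^ t := by
    intro n
    rcases (A n).eq_empty_or_nonempty with hn | hn
    · simp [hn, ht]
    · exact le_iSup (fun _ : (A n).Nonempty => Metric.ediam (A n) ^ t) hn
  have : c < c :=
    calc c ≤ ∑ n ∈ F, Metric.ediam (V n) ^ t := h F V hF
      _ ≤ ∑ n ∈ F, ((⨆ _ : (A n).Nonempty, Metric.ediam (A n) ^ t) + ε n) :=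
          Finset.sum_le_sum fun n _ => (hV n).trans (by gcongr; exact hle n)
      _ ≤ ∑' n, ((⨆ _ : (A n).Nonempty, Metric.ediam (A n) ^ t) + ε n) := ENNReal.sum_le_tsum F
      _ = (∑' n, ⨆ _ : (A n).Nonempty, Metric.ediam (A n) ^ t) + ∑' n, (ε n : ℝ≥0∞) :=
          ENNReal.tsum_add
      _ < c / 2 + c / 2 := ENNReal.add_lt_add hA hεsum
      _ = c := ENNReal.add_halves c
  exact this.false

/-- Disjoint compact copies in a finite family are uniformly separated. -/
theorem exists_pos_le_edist_of_pairwiseDisjoint {X ι : Type*} [EMetricSpace X] {W : Finset ι}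
    {A : ι → Set X} (hA : ∀ i ∈ W, IsCompact (A i)) (hdisj : (W : Set ι).PairwiseDisjoint A) :
    ∃ d : ℝ≥0∞, d ≠ 0 ∧
      ∀ i ∈ W, ∀ j ∈ W, i ≠ j → ∀ x ∈ A i, ∀ y ∈ A j, d ≤ edist x y := by
  classical
  have h : ∀ p : ι × ι, ∃ r : ℝ≥0, 0 < r ∧
      (p ∈ W.offDiag → ∀ x ∈ A p.1, ∀ y ∈ A p.2, (r : ℝ≥0∞) < edist x y) := by
    intro p
    by_cases hp : p ∈ W.offDiag
    · obtain ⟨h1, h2, h12⟩ := Finset.mem_offDiag.1 hp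
      obtain ⟨r, hr, h⟩ := Metric.exists_pos_forall_lt_edist (hA _ h1) (hA _ h2).isClosed
        (hdisj h1 h2 h12)
      exact ⟨r, hr, fun _ => h⟩
    · exact ⟨1, one_pos, fun h => absurd h hp⟩
  choose r hr h using h
  refine ⟨W.offDiag.inf fun p => (r p : ℝ≥0∞), ?_, fun i hi j hj hij x hx y hy => ?_⟩
  · refine ((Finset.lt_inf_iff ENNReal.zero_lt_top).2 fun p _ => ?_).ne'
    exact_mod_cast hr p
  · have hp : (i, j) ∈ W.offDiag := Finset.mem_offDiag.2 ⟨hi, hj, hij⟩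
    exact (Finset.inf_le hp).trans (h (i, j) hp x hx y hy).le

/-- A compact set containing `N` disjoint copies of itself, each shrunk by a factor at least `a`,
satisfies `N * a ^ s ≤ 1` for its Hausdorff dimension `s`. -/
theorem card_mul_rpow_dimH_le_one {X ι : Type*} [EMetricSpace X] {K : Set X} (hK : K.Nonempty)
    (hKc : IsCompact K) {s : ℝ≥0} (hs : dimH K = s) {a : ℝ≥0} (ha : a ≠ 0) (ha1 : a ≤ 1)
    {W : Finset ι} {f : ι → X → X} (hfc : ∀ i ∈ W, Continuous (f i))
    (hf : ∀ i ∈ W, AntilipschitzWith a⁻¹ (f i)) (hfK : ∀ i ∈ W, MapsTo (f i) K K)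
    (hdisj : (W : Set ι).PairwiseDisjoint fun i => f i '' K) :
    (W.card : ℝ≥0∞) * (a : ℝ≥0∞) ^ (s : ℝ) ≤ 1 := by
  borelize X
  by_contra! hlt
  have hcast : ∀ t : ℝ, (W.card : ℝ≥0∞) * (a : ℝ≥0∞) ^ t = ((W.card * a ^ t : ℝ≥0) : ℝ≥0∞) := by
    intro t
    rw [ENNReal.coe_mul, ENNReal.coe_rpow_of_ne_zero ha, ENNReal.coe_natCast]
  have hcont : Continuous fun t : ℝ≥0 => (W.card : ℝ≥0) * a ^ (t : ℝ) :=
    continuous_const.mul (continuous_iff_continuousAt.2 fun t =>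
      (NNReal.continuousAt_rpow (Or.inl ha)).comp
        (f := fun t : ℝ≥0 => (a, (t : ℝ))) (by fun_prop))
  rw [hcast, ENNReal.one_lt_coe_iff] at hlt
  -- The strict inequality at `s` persists at some exponent `t > s`.
  have hev : ∀ᶠ t : ℝ≥0 in nhdsWithin s (Ioi s), 1 < (W.card : ℝ≥0) * a ^ (t : ℝ) :=
    ((hcont.tendsto s).mono_left nhdsWithin_le_nhds).eventually_const_lt hlt
  obtain ⟨t, ht, hst⟩ := (hev.and self_mem_nhdsWithin).exists
  have ht0 : (0 : ℝ) < t := by exact_mod_cast (zero_le).trans_lt (show s < t from hst)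
  have hcardW : 1 < W.card := by
    have : (1 : ℝ≥0) < W.card :=
      hlt.trans_le (mul_le_of_le_one_right zero_le (NNReal.rpow_le_one ha1 s.2))
    exact_mod_cast this
  obtain ⟨d, hd0, hd⟩ := exists_pos_le_edist_of_pairwiseDisjoint
    (fun i hi => hKc.image (hfc i hi)) hdisj
  have hcard : 1 ≤ (W.card : ℝ≥0∞) * (a : ℝ≥0∞) ^ (t : ℝ) := by
    rw [hcast]
    exact_mod_cast ht.le
  have hne : μH[(t : ℝ)] K ≠ 0 := hausdorffMeasure_ne_zero_of_le_sum_ediam hKc ht0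
    (c := d ^ (t : ℝ)) (by simp [ENNReal.rpow_eq_zero_iff, hd0])
    (rpow_le_sum_ediam_of_separated_copies hK ht0.le ha hf hfK hd hcardW hcard)
  have hle := le_dimH_of_hausdorffMeasure_ne_zero hne
  rw [hs] at hle
  exact (show s < t from hst).not_ge (by exact_mod_cast hle)

/-! ### Words, ratios and maximal disjoint families of copies -/

namespace LinearIFS

variable {m : ℕ} (S : LinearIFS m)

/-- The contraction ratio of `S_w` for a word `w`. -/
noncomputable def wordRatio (w : List (Fin m)) : ℝ≥0 := (w.map fun j => ‖S.ρ j‖₊).prod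

theorem edist_wordMap (w : List (Fin m)) (x y : ℝ) :
    edist (S.wordMap w x) (S.wordMap w y) = S.wordRatio w * edist x y := by
  induction w with
  | nil => simp [wordMap, wordRatio]
  | cons j w ih =>
    have h : ∀ u v : ℝ, edist (S.map j u) (S.map j v) = ‖S.ρ j‖₊ * edist u v := by
      intro u v
      rw [edist_nndist, edist_nndist, ← ENNReal.coe_mul]
      congr 1
      rw [nndist_eq_nnnorm, nndist_eq_nnnorm, ← nnnorm_mul]
      congr 1
      unfold LinearIFS.map
      ring
    simp only [wordMap, Function.comp_apply, h, ih, wordRatio, List.map_cons, List.prod_cons,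
      ENNReal.coe_mul, mul_assoc]

theorem wordRatio_ne_zero (w : List (Fin m)) : S.wordRatio w ≠ 0 := by
  refine List.prod_ne_zero fun h => ?_
  obtain ⟨j, -, hj⟩ := List.mem_map.1 h
  exact (_root_.abs_pos.1 (S.abs_pos j)) (nnnorm_eq_zero.1 hj)

theorem lipschitzWith_wordMap (w : List (Fin m)) :
    LipschitzWith (S.wordRatio w) (S.wordMap w) :=
  fun x y => (S.edist_wordMap w x y).le

theorem antilipschitzWith_wordMap (w : List (Fin m)) :
    AntilipschitzWith (S.wordRatio w)⁻¹ (S.wordMap w) := fun x y => by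
  have h := S.wordRatio_ne_zero w
  rw [edist_wordMap, ENNReal.coe_inv h, ← mul_assoc,
    ENNReal.inv_mul_cancel (by simpa using h) ENNReal.coe_ne_top, one_mul]

theorem measurableEmbedding_wordMap (w : List (Fin m)) : MeasurableEmbedding (S.wordMap w) :=
  ((S.antilipschitzWith_wordMap w).isClosedEmbedding
    (S.lipschitzWith_wordMap w).uniformContinuous).measurableEmbedding

theorem IsAttractor.mapsTo_wordMap {S : LinearIFS m} {K : Set ℝ} (hK : S.IsAttractor K)
    (w : List (Fin m)) : MapsTo (S.wordMap w) K K := by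
  induction w with
  | nil => exact mapsTo_id K
  | cons j w ih =>
    intro x hx
    rw [hK.2.2]
    exact mem_iUnion.2 ⟨j, mem_image_of_mem _ (ih hx)⟩

/-- The `s`-dimensional Hausdorff measure of a set grows at most by the factor `ratio ^ s` under
the inverse of `S_w`. -/
theorem wordRatio_rpow_mul_hausdorffMeasure_le {s : ℝ} (hs : 0 ≤ s) (w : List (Fin m))
    (A : Set ℝ) : (S.wordRatio w : ℝ≥0∞) ^ s * μH[s] A ≤ μH[s] (S.wordMap w '' A) := by
  have h := S.wordRatio_ne_zero w
  refine (mul_le_mul_right ((S.antilipschitzWith_wordMap w).le_hausdorffMeasure_image hs A)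
    _).trans ?_
  rw [← mul_assoc, ← ENNReal.mul_rpow_of_nonneg _ _ hs, ENNReal.coe_inv h,
    ENNReal.mul_inv_cancel (by simpa using h) ENNReal.coe_ne_top, ENNReal.one_rpow, one_mul]

/-- Every point of the attractor lies, at every scale `r`, in a copy `S_w(K)` with ratio
comparable to `r`. -/
theorem exists_word_of_mem {K : Set ℝ} (hK : S.IsAttractor K) {p c : ℝ≥0}
    (hc : ∀ j, c ≤ ‖S.ρ j‖₊) (hc1 : c ≤ 1) (hp : ∀ j, ‖S.ρ j‖₊ ≤ p) (n : ℕ) :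
    ∀ r : ℝ≥0, r ≤ 1 → p ^ n ≤ r → ∀ x ∈ K, ∃ w : List (Fin m), w.length ≤ n ∧
      x ∈ S.wordMap w '' K ∧ c * r ≤ S.wordRatio w ∧ S.wordRatio w ≤ r := by
  induction n with
  | zero =>
    intro r hr1 hr x hx
    obtain rfl : r = 1 := le_antisymm hr1 (by simpa using hr)
    exact ⟨[], le_rfl, by simpa [wordMap] using hx, by simpa [wordRatio] using hc1,
      by simp [wordRatio]⟩
  | succ n ih =>
    intro r hr1 hr x hx
    have hx' := hx
    rw [hK.2.2] at hx'
    obtain ⟨j, y, hy, rfl⟩ := mem_iUnion.1 hx'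
    have hj0 : 0 < ‖S.ρ j‖₊ := by simpa using _root_.abs_pos.1 (S.abs_pos j)
    -- Stop as soon as the ratio drops to `r`; otherwise rescale by the first letter. The last
    -- letter overshoots by a factor at least `c`.
    rcases le_or_gt ‖S.ρ j‖₊ r with hjr | hjr
    · refine ⟨[j], by simp, ⟨y, hy, rfl⟩, ?_, by simpa [wordRatio] using hjr⟩
      simpa [wordRatio] using (mul_le_of_le_one_right zero_le hr1).trans (hc j)
    · obtain ⟨w, hw, ⟨z, hz, hzy⟩, h1, h2⟩ := ih (r / ‖S.ρ j‖₊)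
        (div_le_one_of_le₀ hjr.le zero_le)
        (by
          rw [le_div_iff₀ hj0]
          exact (mul_le_mul_right (hp j) _).trans (by rwa [← pow_succ])) y hy
      refine ⟨j :: w, by simpa using hw, ⟨z, hz, by simp [wordMap, hzy]⟩, ?_, ?_⟩
      · rw [← mul_div_assoc, div_le_iff₀ hj0] at h1
        simpa [wordRatio, mul_comm] using h1
      · rw [le_div_iff₀ hj0] at h2
        simpa [wordRatio, mul_comm] using h2

/-- At every scale `r` there are finitely many disjoint copies of `B ⊇ K` with ratios comparable
to `r` whose `D * r`-neighbourhoods cover the attractor. -/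
theorem exists_disjoint_words {K B : Set ℝ} (hK : S.IsAttractor K) (hKB : K ⊆ B) {D : ℝ≥0}
    (hD : Metric.ediam B ≤ D) :
    ∃ c : ℝ≥0, c ≠ 0 ∧ c ≤ 1 ∧ ∀ r : ℝ≥0, r ≠ 0 → r ≤ 1 → ∃ W : Finset (List (Fin m)),
      (W : Set (List (Fin m))).PairwiseDisjoint (fun w => S.wordMap w '' B) ∧
      (∀ w ∈ W, c * r ≤ S.wordRatio w ∧ S.wordRatio w ≤ r) ∧
      K ⊆ ⋃ w ∈ W, Metric.cthickening (D * r : ℝ≥0) (S.wordMap w '' B) := by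
  have hne : Nonempty (Fin m) := by
    obtain ⟨x, hx⟩ := hK.1
    rw [hK.2.2] at hx
    exact ⟨(mem_iUnion.1 hx).choose⟩
  obtain ⟨i, hi⟩ := Finite.exists_min fun j => ‖S.ρ j‖₊
  obtain ⟨k, hk⟩ := Finite.exists_max fun j => ‖S.ρ j‖₊
  have hlt : ∀ j, ‖S.ρ j‖₊ < 1 := fun j => by
    rw [← NNReal.coe_lt_coe]
    simpa using S.abs_lt_one j
  refine ⟨‖S.ρ i‖₊, by simpa using _root_.abs_pos.1 (S.abs_pos i), (hlt i).le, fun r hr hr1 => ?_⟩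
  obtain ⟨n, hn⟩ := exists_pow_lt_of_lt_one (pos_iff_ne_zero.2 hr) (hlt k)
  let T : Set (List (Fin m)) :=
    {w | w.length ≤ n ∧ ‖S.ρ i‖₊ * r ≤ S.wordRatio w ∧ S.wordRatio w ≤ r}
  have hT : T.Finite := (List.finite_length_le (Fin m) n).subset fun w hw => hw.1
  have hBne : B.Nonempty := hK.1.mono hKB
  -- With constant size function the Vitali lemma yields a maximal disjoint subfamily: every copy
  -- meets a selected one.
  obtain ⟨u, huT, hu, hucov⟩ := Vitali.exists_disjoint_subfamily_covering_enlargement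
    (fun w => S.wordMap w '' B) T (fun _ => 1) 2 one_lt_two (fun _ _ => zero_le_one) 1
    (fun _ _ => le_rfl) (fun w _ => hBne.image _)
  refine ⟨(hT.subset huT).toFinset, by simpa using hu, fun w hw => ?_, fun x hx => ?_⟩
  · exact (huT ((Set.Finite.mem_toFinset _).1 hw)).2
  · obtain ⟨w, hw, hxw, h1, h2⟩ := S.exists_word_of_mem hK hi (hlt i).le hk n r hr1
      hn.le x hx
    obtain ⟨v, hv, ⟨z, hzw, hzv⟩, -⟩ := hucov w ⟨hw, h1, h2⟩
    refine mem_iUnion₂.2 ⟨v, (Set.Finite.mem_toFinset _).2 hv, ?_⟩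
    refine Metric.mem_cthickening_of_edist_le x z _ _ hzv ?_
    refine (Metric.edist_le_ediam_of_mem (image_mono hKB hxw) hzw).trans ?_
    refine ((S.lipschitzWith_wordMap w).ediam_image_le B).trans ?_
    rw [mul_comm, ENNReal.ofReal_coe_nnreal, ENNReal.coe_mul]
    gcongr

end LinearIFS

/-! ### Premeasures at a fixed scale -/

/-- Each premeasure is an outer measure, so covering costs can be estimated at one scale by
monotonicity and subadditivity before taking the supremum. -/
theorem hausdorffMeasure_eq_iSup_pre {X : Type*} [EMetricSpace X] [MeasurableSpace X]
    [BorelSpace X] (s : ℝ) (A : Set X) : μH[s] A = ⨆ (η : ℝ≥0∞) (_ : 0 < η),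
      OuterMeasure.mkMetric'.pre (fun B : Set X => Metric.ediam B ^ s) η A := by
  rw [hausdorffMeasure, ← Measure.coe_toOuterMeasure, mkMetric_toOuterMeasure]
  simp only [OuterMeasure.mkMetric, OuterMeasure.mkMetric', OuterMeasure.iSup_apply]

theorem pre_le_hausdorffMeasure {X : Type*} [EMetricSpace X] [MeasurableSpace X]
    [BorelSpace X] (s : ℝ) {η : ℝ≥0∞} (hη : 0 < η) (A : Set X) :
    OuterMeasure.mkMetric'.pre (fun B : Set X => Metric.ediam B ^ s) η A ≤ μH[s] A := by
  rw [hausdorffMeasure_eq_iSup_pre]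
  exact le_iSup₂ (f := fun η (_ : 0 < η) =>
    OuterMeasure.mkMetric'.pre (fun B : Set X => Metric.ediam B ^ s) η A) η hη

namespace LinearIFS

variable {m : ℕ} (S : LinearIFS m)

/-- The scale-`η` Hausdorff premeasure of a set covered by neighbourhoods of copies of `B`. -/
theorem pre_le_of_subset_iUnion_cthickening {K B : Set ℝ} {D r : ℝ≥0}
    (hD : Metric.ediam B ≤ D) {s : ℝ} (hs : 0 ≤ s) {W : Finset (List (Fin m))}
    (hW : ∀ w ∈ W, S.wordRatio w ≤ r)
    (hcov : K ⊆ ⋃ w ∈ W, Metric.cthickening (D * r : ℝ≥0) (S.wordMap w '' B)) {η : ℝ≥0∞}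
    (hη : 3 * D * r ≤ η) :
    OuterMeasure.mkMetric'.pre (fun A : Set ℝ => Metric.ediam A ^ s) η K ≤
      W.card * (3 * D * r : ℝ≥0∞) ^ s := by
  have hdiam : ∀ w ∈ W, Metric.ediam (Metric.cthickening (D * r : ℝ≥0) (S.wordMap w '' B)) ≤
      3 * D * r := by
    intro w hw
    refine (Metric.ediam_cthickening_le _).trans ?_
    calc Metric.ediam (S.wordMap w '' B) + 2 * ((D * r : ℝ≥0) : ℝ≥0∞)
        ≤ r * D + 2 * ((D * r : ℝ≥0) : ℝ≥0∞) := by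
          gcongr
          refine ((S.lipschitzWith_wordMap w).ediam_image_le B).trans ?_
          gcongr
          exact hW w hw
      _ = 3 * D * r := by
          rw [ENNReal.coe_mul]
          ring
  refine (measure_mono hcov).trans ((measure_biUnion_finset_le W _).trans ?_)
  rw [← nsmul_eq_mul, ← Finset.sum_const]
  refine Finset.sum_le_sum fun w hw => ?_
  refine (OuterMeasure.mkMetric'.pre_le ((hdiam w hw).trans hη)).trans ?_
  gcongr
  exact hdiam w hw

theorem exists_scale (D : ℝ≥0) {η : ℝ≥0∞} (hη : 0 < η) :
    ∃ r : ℝ≥0, r ≠ 0 ∧ r ≤ 1 ∧ (3 * D * r : ℝ≥0∞) ≤ η := by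
  have hcont : Continuous fun r : ℝ≥0 => (3 * D * r : ℝ≥0∞) :=
    (ENNReal.continuous_const_mul (ENNReal.mul_ne_top (by simp) ENNReal.coe_ne_top)).comp
      ENNReal.continuous_coe
  have h1 : ∀ᶠ r : ℝ≥0 in nhdsWithin 0 (Ioi 0), (3 * D * r : ℝ≥0∞) < η :=
    ((hcont.tendsto 0).mono_left nhdsWithin_le_nhds).eventually_lt_const (by simpa using hη)
  have h2 : ∀ᶠ r : ℝ≥0 in nhdsWithin 0 (Ioi 0), r < 1 :=
    nhdsWithin_le_nhds (eventually_lt_nhds one_pos)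
  obtain ⟨r, ⟨h1, h2⟩, h0⟩ := ((h1.and h2).and self_mem_nhdsWithin).exists
  exact ⟨r, (show 0 < r from h0).ne', h2.le, h1.le⟩

/-! ### Finiteness of the measure and the density bound -/

/-- A self-similar set has finite Hausdorff measure in its dimension. -/
theorem IsAttractor.hausdorffMeasure_ne_top {S : LinearIFS m} {K : Set ℝ}
    (hK : S.IsAttractor K) {s : ℝ≥0} (hs : dimH K = s) : μH[(s : ℝ)] K ≠ ∞ := by
  have hKb : Metric.ediam K ≠ ∞ := hK.2.1.isBounded.ediam_ne_top
  obtain ⟨c, hc0, hc1, hW⟩ := S.exists_disjoint_words hK Subset.rfl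
    (D := (Metric.ediam K).toNNReal) (by rw [ENNReal.coe_toNNReal hKb])
  set D := (Metric.ediam K).toNNReal
  have hc0' : (c : ℝ≥0∞) ≠ 0 := by simpa using hc0
  have hbound : μH[(s : ℝ)] K ≤ (3 * D / c : ℝ≥0∞) ^ (s : ℝ) := by
    rw [hausdorffMeasure_eq_iSup_pre]
    refine iSup₂_le fun η hη => ?_
    obtain ⟨r, hr0, hr1, hr⟩ := exists_scale D hη
    obtain ⟨W, hdisj, hratio, hcov⟩ := hW r hr0 hr1
    have hcard : (W.card : ℝ≥0∞) * ((c * r : ℝ≥0) : ℝ≥0∞) ^ (s : ℝ) ≤ 1 :=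
      card_mul_rpow_dimH_le_one hK.1 hK.2.1 hs (mul_ne_zero hc0 hr0) (mul_le_one' hc1 hr1)
        (fun w _ => (S.lipschitzWith_wordMap w).continuous)
        (fun w hw x y => (S.antilipschitzWith_wordMap w x y).trans (by
          gcongr
          exact (hratio w hw).1))
        (fun w _ => hK.mapsTo_wordMap w) hdisj
    refine (S.pre_le_of_subset_iUnion_cthickening (by rw [ENNReal.coe_toNNReal hKb]) s.2
      (fun w hw => (hratio w hw).2) hcov hr).trans ?_
    -- The factor `c * r` is absorbed by the packing bound, leaving a constant independent of `r`.
    have hsplit : (3 * D * r : ℝ≥0∞) = (c * r : ℝ≥0) * (3 * D / c) := by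
      rw [ENNReal.coe_mul, mul_comm (c : ℝ≥0∞), mul_assoc (r : ℝ≥0∞),
        ENNReal.mul_div_cancel hc0' ENNReal.coe_ne_top, mul_comm]
    rw [hsplit, ENNReal.mul_rpow_of_nonneg _ _ s.2, ← mul_assoc]
    exact mul_le_of_le_one_left zero_le hcard
  refine (hbound.trans_lt ?_).ne
  exact ENNReal.rpow_lt_top_of_nonneg s.2
    (ENNReal.div_ne_top (ENNReal.mul_ne_top (by simp) ENNReal.coe_ne_top) hc0')

/-- For a self-similar set, no bounded measurable set has Hausdorff measure, in the dimension
of the set, larger than the corresponding power of its diameter. -/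
theorem IsAttractor.hausdorffMeasure_inter_le {S : LinearIFS m} {K : Set ℝ}
    (hK : S.IsAttractor K) {s : ℝ≥0} (hs : dimH K = s) {J : Set ℝ} (hJm : MeasurableSet J)
    (hJb : Bornology.IsBounded J) :
    μH[(s : ℝ)] (K ∩ J) ≤ Metric.ediam J ^ (s : ℝ) := by
  by_contra! hlt
  have hs0 : (0 : ℝ) ≤ s := s.2
  have hfin := hK.hausdorffMeasure_ne_top hs
  have hKJ0 : 0 < μH[(s : ℝ)] (K ∩ J) := (zero_le).trans_lt hlt
  obtain ⟨δ, hδ0, hδ⟩ := ENNReal.lt_iff_exists_add_pos_lt.1 hlt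
  have hδ0' : (δ : ℝ≥0∞) ≠ 0 := by simpa using hδ0.ne'
  have hBb : Metric.ediam (K ∪ J) ≠ ∞ := (hK.2.1.isBounded.union hJb).ediam_ne_top
  -- The summand 1 keeps `D` positive, so that `E` below can be cancelled.
  let D : ℝ≥0 := (Metric.ediam (K ∪ J)).toNNReal + 1
  have hD : Metric.ediam (K ∪ J) ≤ D := by
    rw [ENNReal.coe_add, ENNReal.coe_toNNReal hBb]
    exact le_self_add
  have hD0 : (D : ℝ≥0∞) ≠ 0 := by
    simp [D]
  obtain ⟨c, hc0, -, hW⟩ := S.exists_disjoint_words hK subset_union_left hD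
  have hc0' : (c : ℝ≥0∞) ≠ 0 := by simpa using hc0
  let P : ℝ≥0∞ → OuterMeasure ℝ :=
    OuterMeasure.mkMetric'.pre fun A : Set ℝ => Metric.ediam A ^ (s : ℝ)
  have hKpos : 0 < μH[(s : ℝ)] K := hKJ0.trans_le (measure_mono inter_subset_left)
  -- Fixed once, this scale bounds the number of copies from below, and so makes `gain` independent
  -- of `η`.
  obtain ⟨η₀, hη₀, hP₀⟩ : ∃ η₀ : ℝ≥0∞, 0 < η₀ ∧ 0 < P η₀ K := by
    rw [hausdorffMeasure_eq_iSup_pre] at hKpos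
    obtain ⟨η₀, h⟩ := lt_iSup_iff.1 hKpos
    obtain ⟨h0, h⟩ := lt_iSup_iff.1 h
    exact ⟨η₀, h0, h⟩
  let E : ℝ≥0∞ := (3 * D : ℝ≥0∞)
  have hE0 : E ≠ 0 := mul_ne_zero (by simp) hD0
  have hEtop : E ≠ ∞ := ENNReal.mul_ne_top (by simp) ENNReal.coe_ne_top
  let gain : ℝ≥0∞ := (c / E) ^ (s : ℝ) * P η₀ K * δ
  have hgain : gain ≠ 0 := by
    refine mul_ne_zero (mul_ne_zero ?_ hP₀.ne') hδ0'
    exact (ENNReal.rpow_pos_of_nonneg (ENNReal.div_pos hc0' hEtop) hs0).ne'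
  have hmain : ∀ η : ℝ≥0∞, 0 < η → P η K + gain ≤ μH[(s : ℝ)] K := by
    intro η hη
    obtain ⟨r, hr0, hr1, hr⟩ := exists_scale D (lt_min hη hη₀)
    obtain ⟨W, hdisj, hratio, hcov⟩ := hW r hr0 hr1
    have hdisjJ : (W : Set (List (Fin m))).PairwiseDisjoint fun w => S.wordMap w '' J :=
      hdisj.mono fun w => image_mono subset_union_right
    let U : Set ℝ := ⋃ w ∈ W, S.wordMap w '' J
    have hUm : MeasurableSet U := Finset.measurableSet_biUnion W fun w _ =>
      (S.measurableEmbedding_wordMap w).measurableSet_image.2 hJm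
    let ratioSum : ℝ≥0∞ := ∑ w ∈ W, (S.wordRatio w : ℝ≥0∞) ^ (s : ℝ)
    have hgain_le : gain ≤ ratioSum * δ := by
      -- The enlarged copies, of diameter at most `E * r`, cover `K`, so their number is at least `P
      -- η₀ K / (E * r) ^ s`.
      refine mul_le_mul_left ?_ _
      calc (c / E) ^ (s : ℝ) * P η₀ K
          ≤ (c / E) ^ (s : ℝ) * (W.card * (E * r) ^ (s : ℝ)) := by
            gcongr
            exact S.pre_le_of_subset_iUnion_cthickening hD hs0 (fun w hw => (hratio w hw).2) hcov
              (hr.trans (min_le_right _ _))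
        _ = W.card * (c * r : ℝ≥0∞) ^ (s : ℝ) := by
            rw [mul_left_comm, ← ENNReal.mul_rpow_of_nonneg _ _ hs0, ← mul_assoc,
              ENNReal.div_mul_cancel hE0 hEtop]
        _ = ∑ w ∈ W, (c * r : ℝ≥0∞) ^ (s : ℝ) := by rw [Finset.sum_const, nsmul_eq_mul]
        _ ≤ ratioSum := by
            refine Finset.sum_le_sum fun w hw => ?_
            gcongr
            exact_mod_cast (hratio w hw).1
    have hdiamU : P η U ≤ ratioSum * Metric.ediam J ^ (s : ℝ) := by
      refine (measure_biUnion_finset_le W _).trans ?_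
      rw [Finset.sum_mul]
      refine Finset.sum_le_sum fun w hw => ?_
      have hdiam : Metric.ediam (S.wordMap w '' J) ≤ S.wordRatio w * Metric.ediam J :=
        (S.lipschitzWith_wordMap w).ediam_image_le J
      have hle : Metric.ediam (S.wordMap w '' J) ≤ η := by
        refine (hdiam.trans ?_).trans (hr.trans (min_le_left _ _))
        rw [mul_comm]
        gcongr
        · exact (Metric.ediam_mono subset_union_right).trans
            (hD.trans (le_mul_of_one_le_left zero_le (by norm_num)))
        · exact (hratio w hw).2
      refine (OuterMeasure.mkMetric'.pre_le hle).trans ?_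
      rw [← ENNReal.mul_rpow_of_nonneg _ _ hs0]
      gcongr
    have hmassU : ratioSum * μH[(s : ℝ)] (K ∩ J) ≤ μH[(s : ℝ)] (K ∩ U) := by
      calc ratioSum * μH[(s : ℝ)] (K ∩ J)
          ≤ ∑ w ∈ W, μH[(s : ℝ)] (K ∩ S.wordMap w '' J) := by
            rw [Finset.sum_mul]
            refine Finset.sum_le_sum fun w _ => ?_
            refine (S.wordRatio_rpow_mul_hausdorffMeasure_le hs0 w _).trans (measure_mono ?_)
            rintro _ ⟨x, ⟨hxK, hxJ⟩, rfl⟩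
            exact ⟨hK.mapsTo_wordMap w hxK, mem_image_of_mem _ hxJ⟩
        _ = μH[(s : ℝ)] (⋃ w ∈ W, K ∩ S.wordMap w '' J) :=
            (measure_biUnion_finset (hdisjJ.mono fun w => inter_subset_right) fun w _ =>
              hK.2.1.measurableSet.inter
                ((S.measurableEmbedding_wordMap w).measurableSet_image.2 hJm)).symm
        _ = μH[(s : ℝ)] (K ∩ U) := by rw [inter_iUnion₂]
    -- Cover `U` by the copies of `J` and the rest of `K` optimally; the excess `δ` in each copy of
    -- `J` is saved.
    calc P η K + gain ≤ (P η U + P η (K \ U)) + ratioSum * δ := by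
          gcongr
          exact (measure_mono (by rw [union_sdiff_self]; exact subset_union_right)).trans
            (measure_union_le U (K \ U))
      _ ≤ (ratioSum * Metric.ediam J ^ (s : ℝ) + μH[(s : ℝ)] (K \ U)) + ratioSum * δ := by
          gcongr
          exact pre_le_hausdorffMeasure (s : ℝ) hη (K \ U)
      _ = ratioSum * (Metric.ediam J ^ (s : ℝ) + δ) + μH[(s : ℝ)] (K \ U) := by ring
      _ ≤ μH[(s : ℝ)] (K ∩ U) + μH[(s : ℝ)] (K \ U) := by
          gcongr
          exact (mul_le_mul_right hδ.le _).trans hmassU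
      _ = μH[(s : ℝ)] K := measure_inter_add_sdiff K hUm
  -- Letting `η` vary, the supremum inherits the uniform loss `gain`, impossible for a finite
  -- positive measure.
  have hsup : μH[(s : ℝ)] K ≤ μH[(s : ℝ)] K - gain := by
    conv_lhs => rw [hausdorffMeasure_eq_iSup_pre]
    refine iSup₂_le fun η hη => ?_
    have hle := hmain η hη
    have hgtop : gain ≠ ∞ := ((le_add_self.trans hle).trans_lt hfin.lt_top).ne
    exact ENNReal.le_sub_of_add_le_right hgtop hle
  exact (ENNReal.sub_lt_self hfin hKpos.ne' hgain).not_ge hsup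

end LinearIFS

/-- The density bound for the attractor. It is the instance for intervals of
`IsAttractor.hausdorffMeasure_inter_le`, which needs no separation condition: in its Hausdorff
dimension every self-similar set has finite Hausdorff measure, and an interval carrying too much
mass could be copied disjointly into a fixed proportion of the set at every scale, making the
premeasures stay strictly below the measure. -/
theorem theorem1p1 {m : ℕ} (S : LinearIFS m) (K : Set ℝ) (hK : S.IsAttractor K)
    (M : ℕ → Finset (List (Fin m))) (hM : S.IsGFTC M)
    (α : ℝ≥0) (hα : dimH K = α)
    (rep : S.OverlapType M → S.Island M) (hrep : ∀ t, (rep t).type = t)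
    (hirr : (LinearIFS.incidenceMatrix rep (α : ℝ)).IsIrreducible)
    (J : Set ℝ) (hJ : J.OrdConnected) (hJ01 : J ⊆ Icc 0 1) :
    μH[(α : ℝ)] (K ∩ J) ≤ Metric.ediam J ^ (α : ℝ) := by
  exact hK.hausdorffMeasure_inter_le hα hJ.measurableSet ((Metric.isBounded_Icc 0 1).subset hJ01)
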